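/- Let $A$ and $B$ be square matrices of sizes $N,M>1$ with entries in $\{0,1\}$ that are irreducible and satisfy condition (I) of Cuntz and Krieger (every state leads to a state that lies on at least two different first-return loops). Let $(X_A,\sigma_A)$, $(X_B,\sigma_B)$ be their one-sided topological Markov shifts and $(\bar X_A,\bar\sigma_A)$, $(\bar X_B,\bar\sigma_B)$ their two-sided topological Markov shifts. Suppose that $(X_A,\sigma_A)$ and $(X_B,\sigma_B)$ are continuously orbit equivalent through a homeomorphism $h:X_A\to X_B$, that is, there are continuous functions $k_1,l_1:X_A\to\mathbb{Z}_{\ge 0}$ and $k_2,l_2:X_B\to\mathbb{Z}_{\ge 0}$ with $$\sigma_B^{k_1(x)}(h(\sigma_A(x)))=\sigma_B^{l_1(x)}(h(x))\quad(x\in X_A),\qquad \sigma_A^{k_2(y)}(h^{-1}(\sigma_B(y)))=\sigma_A^{l_2(y)}(h^{-1}(y))\quad(y\in X_B).$$ Put $c_1=l_1-k_1$ and $c_2=l_2-k_2$. Notation: $H^A=C(X_A,\mathbb{Z})/\{\xi-\xi\circ\sigma_A\mid \xi\in C(X_A,\mathbb{Z})\}$, and $H^A_+$ is the set of classes of nonnegative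 functions; an element $u\in H^A_+$ is an order unit if for every $g\in H^A$ there is $n\in\mathbb{Z}_{\ge 0}$ with $nu-g\in H^A_+$. For a periodic orbit $\gamma$ of $(\bar X_A,\bar\sigma_A)$ and $f\in C(X_A,\mathbb{Z})$ put $\beta_\gamma([f])=\sum_{\bar x\in\gamma}f(\pi_A(\bar x))$, where $\pi_A:\bar X_A\to X_A$ is the restriction of two-sided sequences to one-sided ones; this depends only on the class $[f]\in H^A$. The zeta function of the two-sided shift and that of an order unit $u$ of $(H^A,H^A_+)$ are $$\zeta_A(t)=\exp\Bigl(\sum_{n=1}^\infty\frac{t^n}{n}\,\bigl|\{\bar x\in\bar X_A\mid\bar\sigma_A^n(\bar x)=\bar x\}\bigr|\Bigr),\qquad \zeta_u(t)=\prod_{\gamma}\bigl(1-t^{\beta_\gamma(u)}\bigr)^{-1},$$ for complex $t$, the product being over all periodic orbits $\gamma$ of $(\bar X_A,\bar\sigma_A)$. The series for $\zeta_A$ is said to converge at $t$ if it converges absolutely; the product for $\zeta_u$ is said to converge absolutely at $t$ if $|t|<1$ and $\sum_\gamma |t^{\beta_\gamma(u)}|<\infty$. The same notation is used for $B$. Then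 $[c_1]$ is an order unit of $(H^A,H^A_+)$ and $[c_2]$ is an order unit of $(H^B,H^B_+)$; the series defining $\zeta_A$ and $\zeta_B$ converge absolutely in a neighbourhood of $0$; and $$\zeta_B(t)=\zeta_{[c_1]}(t)=\prod_{\gamma}\bigl(1-t^{\beta_\gamma([c_1])}\bigr)^{-1},\qquad \zeta_A(t)=\zeta_{[c_2]}(t)=\prod_{\gamma'}\bigl(1-t^{\beta_{\gamma'}([c_2])}\bigr)^{-1},$$ where $\gamma$ and $\gamma'$ run over the periodic orbits of $(\bar X_A,\bar\sigma_A)$ and $(\bar X_B,\bar\sigma_B)$ respectively. More precisely, for every $t\in\mathbb{C}$ the series for $\zeta_B$ converges absolutely at $t$ if and only if the product for $\zeta_{[c_1]}$ does, and in that case the product converges unconditionally and the two values agree; likewise for $\zeta_A$ and $\zeta_{[c_2]}$. -/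

import Mathlib

open Topology

namespace MarkovShift

/-- Admissible interior words of first-return loops at `i`: `w = w₁ ⋯ w_r` such that
`i w₁ ⋯ w_r i` is an admissible word and no `w_k` equals `i`. -/
def IsFirstReturnLoop {N : ℕ} (A : Matrix (Fin N) (Fin N) ℤ) (i : Fin N)
    (w : List (Fin N)) : Prop :=
  List.IsChain (fun a b => A a b = 1) (i :: (w ++ [i])) ∧ i ∉ w

/-- Condition (I) of Cuntz and Krieger: every state leads to a state that lies on
at least two different first-return loops. -/
def ConditionI {N : ℕ} (A : Matrix (Fin N) (Fin N) ℤ) : Prop :=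
  ∀ i, ∃ j, Relation.ReflTransGen (fun a b => A a b = 1) i j ∧
    ∃ v w, v ≠ w ∧ IsFirstReturnLoop A j v ∧ IsFirstReturnLoop A j w

/-- The standing assumptions on a transition matrix: more than one state, entries in `{0, 1}`,
irreducibility, and condition (I). -/
structure IsTransitionMatrix {N : ℕ} (A : Matrix (Fin N) (Fin N) ℤ) : Prop where
  one_lt : 1 < N
  zero_or_one : ∀ i j, A i j = 0 ∨ A i j = 1
  irreducible : A.IsIrreducible
  conditionI : ConditionI A

/-- The shift space of the right one-sided topological Markov shift (coordinates are
indexed from `0`), with the topology induced by the product topology. -/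
abbrev OneSided {N : ℕ} (A : Matrix (Fin N) (Fin N) ℤ) : Type :=
  {x : ℕ → Fin N // ∀ n, A (x n) (x (n + 1)) = 1}

/-- The shift space of the two-sided topological Markov shift. -/
abbrev TwoSided {N : ℕ} (A : Matrix (Fin N) (Fin N) ℤ) : Type :=
  {x : ℤ → Fin N // ∀ n, A (x n) (x (n + 1)) = 1}

section

variable {N : ℕ} (A : Matrix (Fin N) (Fin N) ℤ)

/-- The one-sided shift map, as a continuous map. -/
def shift : C(OneSided A, OneSided A) where
  toFun x := ⟨fun n => x.1 (n + 1), fun n => x.2 (n + 1)⟩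
  continuous_toFun := by
    refine Continuous.subtype_mk (continuous_pi fun n => ?_) _
    exact (continuous_apply (n + 1)).comp continuous_subtype_val

/-- The two-sided shift map, as a bijection. -/
def shiftTwo : Equiv.Perm (TwoSided A) where
  toFun x := ⟨fun n => x.1 (n + 1), fun n => x.2 (n + 1)⟩
  invFun x := ⟨fun n => x.1 (n - 1), fun n => by
    have h := x.2 (n - 1)
    rwa [show n - 1 + 1 = n + 1 - 1 by ring] at h⟩
  left_inv x := by ext n; simp
  right_inv x := by ext n; simp

/-- The restriction map from the two-sided to the one-sided shift space. -/
def restrict (x : TwoSided A) : OneSided A :=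
  ⟨fun n => x.1 n, fun n => by simpa using x.2 n⟩

theorem restrict_shiftTwo (x : TwoSided A) :
    restrict A (shiftTwo A x) = shift A (restrict A x) := by
  ext n; simp [restrict, shiftTwo, shift]

/-- The homomorphism `ξ ↦ ξ - ξ ∘ σ` on the group of integer-valued continuous functions. -/
def coboundary : C(OneSided A, ℤ) →+ C(OneSided A, ℤ) where
  toFun ξ := ξ - ξ.comp (shift A)
  map_zero' := by ext; simp
  map_add' ξ η := by ext; simp; ring

/-- The cohomology group of the one-sided shift. -/
abbrev Cohomology : Type :=
  C(OneSided A, ℤ) ⧸ (coboundary A).range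

/-- The class of a continuous function in the cohomology group. -/
def cls (f : C(OneSided A, ℤ)) : Cohomology A := QuotientAddGroup.mk f

/-- The positive cone: the classes of nonnegative continuous functions. -/
def positiveCone : Set (Cohomology A) :=
  {u | ∃ f : C(OneSided A, ℤ), (∀ x, 0 ≤ f x) ∧ cls A f = u}

/-- Order units of the cohomology group with respect to its positive cone. -/
def IsOrderUnit (u : Cohomology A) : Prop :=
  u ∈ positiveCone A ∧ ∀ g : Cohomology A, ∃ n : ℕ, n • u - g ∈ positiveCone A

/-- The set of points of the two-sided shift that are fixed by the `p`-th power of the shift. -/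
def Per (p : ℕ) : Set (TwoSided A) :=
  {x | (shiftTwo A ^ p) x = x}

/-- The set of periodic orbits of the two-sided shift. -/
def PeriodicOrbit : Type :=
  {γ : Set (TwoSided A) // ∃ x : TwoSided A, (∃ p : ℕ, 1 ≤ p ∧ x ∈ Per A p) ∧
    γ = Set.range fun n : ℤ => (shiftTwo A ^ n) x}

variable {A}

theorem PeriodicOrbit.finite (γ : PeriodicOrbit A) : γ.1.Finite := by
  obtain ⟨_, x, ⟨p, hp, hx⟩, rfl⟩ := γ
  have hx' : (shiftTwo A ^ (p : ℤ)) x = x := by simpa [Per] using hx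
  refine ((Set.finite_Ico (0 : ℤ) p).image fun n => (shiftTwo A ^ n) x).subset ?_
  rintro _ ⟨n, rfl⟩
  refine ⟨n % p, ⟨Int.emod_nonneg _ (by omega), Int.emod_lt_of_pos _ (by omega)⟩, ?_⟩
  have h : (shiftTwo A ^ ((p : ℤ) * (n / p))) x = x := by
    rw [zpow_mul]
    exact Function.IsFixedPt.perm_zpow (e := shiftTwo A ^ (p : ℤ)) hx' _
  change (shiftTwo A ^ (n % p)) x = (shiftTwo A ^ n) x
  conv_rhs => rw [← Int.emod_add_mul_ediv n p, zpow_add, Equiv.Perm.mul_apply, h]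

theorem PeriodicOrbit.bijOn (γ : PeriodicOrbit A) : Set.BijOn (shiftTwo A) γ.1 γ.1 := by
  obtain ⟨_, x, -, rfl⟩ := γ
  refine ⟨?_, (shiftTwo A).injective.injOn, ?_⟩
  · rintro _ ⟨n, rfl⟩
    exact ⟨1 + n, by simp [zpow_add]⟩
  · rintro _ ⟨n, rfl⟩
    refine ⟨_, ⟨n - 1, rfl⟩, ?_⟩
    rw [← Equiv.Perm.mul_apply, ← zpow_one_add]
    congr 2
    ring

/-- The sum of a function on the one-sided shift space over a periodic orbit of the two-sided
shift. The restriction map is injective on such an orbit and carries it onto a periodic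
orbit of the one-sided shift, so this is the sum over the latter. -/
noncomputable def orbitSum (γ : PeriodicOrbit A) : C(OneSided A, ℤ) →+ ℤ where
  toFun f := ∑ᶠ x ∈ γ.1, f (restrict A x)
  map_zero' := by simp
  map_add' f g := by
    simpa using finsum_mem_add_distrib (f := fun x => f (restrict A x))
      (g := fun x => g (restrict A x)) γ.finite

theorem orbitSum_coboundary (γ : PeriodicOrbit A) (ξ : C(OneSided A, ℤ)) :
    orbitSum γ (coboundary A ξ) = 0 := by
  have h : orbitSum γ ξ = orbitSum γ (ξ.comp (shift A)) :=
    (finsum_mem_eq_of_bijOn _ γ.bijOn fun x _ => by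
      simp [restrict_shiftTwo]).symm
  change orbitSum γ (ξ - ξ.comp (shift A)) = 0
  rw [map_sub, h, sub_self]

/-- The homomorphism `β_γ` on the cohomology group given by summation over the orbit `γ`. -/
noncomputable def beta (γ : PeriodicOrbit A) : Cohomology A →+ ℤ :=
  QuotientAddGroup.lift _ (orbitSum γ) (by
    rintro _ ⟨ξ, rfl⟩
    exact orbitSum_coboundary γ ξ)

variable (A)

/-- (Absolute) convergence of the series `∑_{n ≥ 1} |Per_n| tⁿ / n`. -/
def ZetaConverges (t : ℂ) : Prop :=
  Summable fun n : ℕ => t ^ (n + 1) / ((n + 1 : ℕ) : ℂ) * ((Per A (n + 1)).ncard : ℂ)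

/-- The zeta function of the two-sided shift,
`ζ_A(t) = exp (∑_{n ≥ 1} |Per_n| tⁿ / n)`. -/
noncomputable def zeta (t : ℂ) : ℂ :=
  Complex.exp (∑' n : ℕ, t ^ (n + 1) / ((n + 1 : ℕ) : ℂ) * ((Per A (n + 1)).ncard : ℂ))

variable {A}

/-- Absolute convergence, at a point of the open unit disc, of the product
`∏_γ (1 - t ^ β_γ(u))⁻¹` over all periodic orbits. -/
def UnitZetaConverges (u : Cohomology A) (t : ℂ) : Prop :=
  ‖t‖ < 1 ∧ Summable fun γ : PeriodicOrbit A => t ^ beta γ u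

/-- The zeta function of an order unit `u`, `ζ_u(t) = ∏_γ (1 - t ^ β_γ(u))⁻¹`, the product
being taken over all periodic orbits of the two-sided shift. -/
noncomputable def unitZeta (u : Cohomology A) (t : ℂ) : ℂ :=
  ∏' γ : PeriodicOrbit A, (1 - t ^ beta γ u)⁻¹

/-- The cocycle function `l - k`. -/
def cocycle (k l : C(OneSided A, ℕ)) : C(OneSided A, ℤ) where
  toFun x := (l x : ℤ) - (k x : ℤ)
  continuous_toFun := by
    have hk : Continuous fun x => ((k x : ℕ) : ℤ) := continuous_of_discreteTopology.comp k.continuous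
    have hl : Continuous fun x => ((l x : ℕ) : ℤ) := continuous_of_discreteTopology.comp l.continuous
    exact hl.sub hk

end

/-- `h` is a continuous orbit equivalence between the two one-sided shifts, with the continuous
functions `k₁, l₁, k₂, l₂` realizing it. (The two identities imply that `h` maps orbits
onto orbits.) -/
structure IsContinuousOrbitEquivalence {N M : ℕ} {A : Matrix (Fin N) (Fin N) ℤ}
    {B : Matrix (Fin M) (Fin M) ℤ} (h : OneSided A ≃ₜ OneSided B)
    (k₁ l₁ : C(OneSided A, ℕ)) (k₂ l₂ : C(OneSided B, ℕ)) : Prop where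
  forward : ∀ x, (shift B)^[k₁ x] (h (shift A x)) = (shift B)^[l₁ x] (h x)
  backward : ∀ y, (shift A)^[k₂ y] (h.symm (shift B y)) = (shift A)^[l₂ y] (h.symm y)

end MarkovShift

namespace MarkovShift

open Function

section

variable {N M : ℕ} {A : Matrix (Fin N) (Fin N) ℤ} {B : Matrix (Fin M) (Fin M) ℤ}

/-! ### Cylinders and gluing -/

theorem shift_iterate_apply (x : OneSided A) (n i : ℕ) :
    ((shift A)^[n] x).1 i = x.1 (i + n) := by
  induction n generalizing x with
  | zero => rfl
  | succ n ih =>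
    rw [iterate_succ_apply, ih]
    rfl

theorem continuous_shift_iterate (n : ℕ) : Continuous ((shift A)^[n]) :=
  (shift A).continuous.iterate n

theorem isOpen_setOf_agree (x : OneSided A) (m : ℕ) :
    IsOpen {y : OneSided A | ∀ i < m, y.1 i = x.1 i} :=
  (PiNat.isOpen_cylinder (fun _ => Fin N) x.1 m).preimage continuous_subtype_val

theorem exists_agree_subset {U : Set (OneSided A)} (hU : IsOpen U) {x : OneSided A}
    (hx : x ∈ U) : ∃ m, ∀ y : OneSided A, (∀ i < m, y.1 i = x.1 i) → y ∈ U := by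
  obtain ⟨V, hV, rfl⟩ := isOpen_induced_iff.1 hU
  obtain ⟨_, ⟨z, n, rfl⟩, hxz, hzV⟩ :=
    (PiNat.isTopologicalBasis_cylinders fun _ => Fin N).exists_subset_of_mem_open hx hV
  refine ⟨n, fun y hy => hzV ?_⟩
  rw [PiNat.mem_cylinder_iff] at hxz ⊢
  exact fun i hi => (hy i hi).trans (hxz i hi)

instance compactSpace_oneSided : CompactSpace (OneSided A) := by
  refine isCompact_iff_compactSpace.1 (IsClosed.isCompact ?_)
  have : {x : ℕ → Fin N | ∀ n, A (x n) (x (n + 1)) = 1} =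
      ⋂ n, (fun x : ℕ → Fin N => (x n, x (n + 1))) ⁻¹' {p | A p.1 p.2 = 1} := by
    ext; simp
  change IsClosed {x : ℕ → Fin N | ∀ n, A (x n) (x (n + 1)) = 1}
  rw [this]
  exact isClosed_iInter fun n => (isClosed_discrete _).preimage (by fun_prop)

theorem exists_agree_imp_eq {Y : Type*} [TopologicalSpace Y] [DiscreteTopology Y]
    {f : OneSided A → Y} (hf : Continuous f) :
    ∃ m, ∀ x y : OneSided A, (∀ i < m, x.1 i = y.1 i) → f x = f y := by
  have hloc : ∀ x : OneSided A, ∃ m, ∀ y : OneSided A, (∀ i < m, y.1 i = x.1 i) → f y = f x :=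
    fun x => exists_agree_subset ((isOpen_discrete {f x}).preimage hf) rfl
  choose m hm using hloc
  obtain ⟨t, ht⟩ := isCompact_univ.elim_nhds_subcover
    (fun x => {y : OneSided A | ∀ i < m x, y.1 i = x.1 i})
    fun x _ => (isOpen_setOf_agree x (m x)).mem_nhds fun _ _ => rfl
  refine ⟨t.sup m, fun x y hxy => ?_⟩
  obtain ⟨z, hz, hxz⟩ := Set.mem_iUnion₂.1 (ht.2 (Set.mem_univ y))
  rw [hm z y hxz, hm z x fun i hi => (hxy i (hi.trans_le (Finset.le_sup hz))).trans (hxz i hi)]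

/-- The point that follows `x` up to the coordinate `n` and `z` from there on. -/
def glue (x : ℕ → Fin N) (n : ℕ) (z : OneSided A) (hx : ∀ i < n, A (x i) (x (i + 1)) = 1)
    (hz : z.1 0 = x n) : OneSided A :=
  ⟨fun i => if i < n then x i else z.1 (i - n), fun i => by
    rcases lt_trichotomy (i + 1) n with h | h | h
    · simpa [h, (Nat.lt_succ_self i).trans h] using hx i (by omega)
    · simpa [← h, hz] using hx i (by omega)
    · have h1 : ¬ i < n := by omega
      have h2 : ¬ i + 1 < n := by omega
      simpa [h1, h2, show i + 1 - n = i - n + 1 by omega] using z.2 (i - n)⟩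

theorem glue_apply {x : ℕ → Fin N} {n : ℕ} {z : OneSided A}
    {hx : ∀ i < n, A (x i) (x (i + 1)) = 1} {hz : z.1 0 = x n} {i : ℕ} (hi : i ≤ n) :
    (glue x n z hx hz).1 i = x i := by
  rcases hi.lt_or_eq with h | rfl
  · simp [glue, h]
  · simp [glue, hz]

theorem glue_apply_add {x : ℕ → Fin N} {n : ℕ} {z : OneSided A}
    {hx : ∀ i < n, A (x i) (x (i + 1)) = 1} {hz : z.1 0 = x n} (i : ℕ) :
    (glue x n z hx hz).1 (i + n) = z.1 i := by
  simp [glue]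

theorem shift_iterate_glue {x : ℕ → Fin N} {n : ℕ} {z : OneSided A}
    {hx : ∀ i < n, A (x i) (x (i + 1)) = 1} {hz : z.1 0 = x n} :
    (shift A)^[n] (glue x n z hx hz) = z := by
  ext i
  rw [shift_iterate_apply, glue_apply_add]

/-! ### Paths -/

/-- There is an admissible word of length `n + 1` from `i` to `j`. -/
def HasPath (A : Matrix (Fin N) (Fin N) ℤ) (i j : Fin N) (n : ℕ) : Prop :=
  ∃ w : ℕ → Fin N, w 0 = i ∧ w n = j ∧ ∀ k < n, A (w k) (w (k + 1)) = 1

theorem HasPath.refl (i : Fin N) : HasPath A i i 0 := ⟨fun _ => i, rfl, rfl, by simp⟩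

theorem HasPath.tail {i j k : Fin N} {n : ℕ} (h : HasPath A i j n) (hjk : A j k = 1) :
    HasPath A i k (n + 1) := by
  obtain ⟨w, rfl, rfl, hw⟩ := h
  refine ⟨fun m => if m ≤ n then w m else k, by simp, by simp, fun m hm => ?_⟩
  rcases (Nat.lt_succ_iff.1 hm).lt_or_eq with h | rfl
  · simpa [h.le, Nat.succ_le_of_lt h] using hw m h
  · simpa using hjk

theorem exists_hasPath_of_reflTransGen {i j : Fin N}
    (h : Relation.ReflTransGen (fun a b => A a b = 1) i j) : ∃ n, HasPath A i j n := by
  induction h with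
  | refl => exact ⟨0, .refl i⟩
  | tail _ h ih =>
    obtain ⟨n, hn⟩ := ih
    exact ⟨n + 1, hn.tail h⟩

namespace IsTransitionMatrix

theorem eq_one_of_pos (hA : IsTransitionMatrix A) {i j : Fin N} (h : 0 < A i j) : A i j = 1 :=
  (hA.zero_or_one i j).resolve_left h.ne'

theorem exists_hasPath (hA : IsTransitionMatrix A) (i j : Fin N) :
    ∃ n, 0 < n ∧ HasPath A i j n := by
  let := A.toQuiver
  obtain ⟨p, hp⟩ := hA.irreducible.connected i j
  refine ⟨p.length, hp, ?_⟩
  clear hp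
  induction p with
  | nil => exact .refl i
  | cons p e ih => exact ih.tail (hA.eq_one_of_pos e.down)

theorem exists_succ (hA : IsTransitionMatrix A) (i : Fin N) : ∃ j, A i j = 1 := by
  obtain ⟨n, hn, w, rfl, -, hw⟩ := hA.exists_hasPath i i
  exact ⟨w 1, hw 0 hn⟩

theorem exists_point (hA : IsTransitionMatrix A) (i : Fin N) : ∃ x : OneSided A, x.1 0 = i := by
  choose s hs using hA.exists_succ
  exact ⟨⟨fun n => s^[n] i, fun n => by
    change A (s^[n] i) (s^[n + 1] i) = 1
    rw [iterate_succ_apply']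
    exact hs _⟩, rfl⟩

theorem exists_branching (hA : IsTransitionMatrix A) (i : Fin N) :
    ∃ j, Relation.ReflTransGen (fun a b => A a b = 1) i j ∧
      ∃ b c, b ≠ c ∧ A j b = 1 ∧ A j c = 1 := by
  by_contra! hcon
  obtain ⟨j, hij, v, w, hvw, ⟨hv, hjv⟩, ⟨hw, hjw⟩⟩ := hA.conditionI i
  have hdet : ∀ a b c, Relation.ReflTransGen (fun a b => A a b = 1) i a → A a b = 1 → A a c = 1 →
      b = c := fun a b c ha hb hc => by
    by_contra hbc
    exact hcon a ha b c hbc hb hc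
  refine hvw ?_
  suffices H : ∀ (v w : List (Fin N)) (a : Fin N),
      Relation.ReflTransGen (fun a b => A a b = 1) i a →
      List.IsChain (fun a b => A a b = 1) (a :: (v ++ [j])) →
      List.IsChain (fun a b => A a b = 1) (a :: (w ++ [j])) → j ∉ v → j ∉ w → v = w from
    H v w j hij hv hw hjv hjw
  intro v
  induction v with
  | nil =>
    intro w a ha hv hw _ hjw
    cases w with
    | nil => rfl
    | cons b w =>
      simp only [List.nil_append, List.cons_append, List.isChain_cons_cons] at hv hw
      exact absurd (hdet a j b ha hv.1 hw.1) (by simp_all)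
  | cons b v ih =>
    intro w a ha hv hw hjv hjw
    cases w with
    | nil =>
      simp only [List.nil_append, List.cons_append, List.isChain_cons_cons] at hv hw
      exact absurd (hdet a j b ha hw.1 hv.1) (by simp_all)
    | cons c w =>
      simp only [List.cons_append, List.isChain_cons_cons] at hv hw
      obtain rfl := hdet a b c ha hv.1 hw.1
      rw [ih w b (ha.tail hv.1) hv.2 hw.2 (by simp_all) (by simp_all)]

/-- No iterate of the shift is constant on a nonempty open set. -/
theorem exists_shift_iterate_ne (hA : IsTransitionMatrix A) {U : Set (OneSided A)}
    (hU : IsOpen U) (hne : U.Nonempty) (K : ℕ) :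
    ∃ x ∈ U, ∃ y ∈ U, (shift A)^[K] x ≠ (shift A)^[K] y := by
  obtain ⟨x, hx⟩ := hne
  obtain ⟨m, hm⟩ := exists_agree_subset hU hx
  obtain ⟨j, hj, b, c, hbc, hb, hc⟩ := hA.exists_branching (x.1 (max m K))
  obtain ⟨r, hr⟩ := exists_hasPath_of_reflTransGen hj
  have key : ∀ b, A j b = 1 → ∃ y ∈ U, y.1 (r + 1 + max m K) = b := by
    intro b hb
    obtain ⟨w, hw0, hwr, hw⟩ := hr.tail hb
    obtain ⟨z, hz⟩ := hA.exists_point b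
    refine ⟨glue x.1 (max m K) (glue w (r + 1) z hw (hz.trans hwr.symm)) (fun i _ => x.2 i)
      ((glue_apply (Nat.zero_le _)).trans hw0), hm _ fun i hi => glue_apply ?_, ?_⟩
    · exact hi.le.trans (le_max_left _ _)
    · rw [glue_apply_add, glue_apply le_rfl, hwr]
  obtain ⟨y, hy, hyb⟩ := key b hb
  obtain ⟨z, hz, hzc⟩ := key c hc
  refine ⟨y, hy, z, hz, fun h => hbc ?_⟩
  have h1 := congrArg (fun u : OneSided A => u.1 (r + 1 + max m K - K)) h
  simp only [shift_iterate_apply] at h1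
  rwa [Nat.sub_add_cancel ((le_max_right m K).trans (Nat.le_add_left _ _)), hyb, hzc] at h1

/-- Two iterates of the shift that agree on a nonempty open set are equal. -/
theorem eq_of_shift_iterate_eq (hA : IsTransitionMatrix A) {U : Set (OneSided A)}
    (hU : IsOpen U) (hne : U.Nonempty) {a b : ℕ}
    (h : ∀ x ∈ U, (shift A)^[a] x = (shift A)^[b] x) : a = b := by
  wlog hab : a < b generalizing a b
  · rcases (not_lt.1 hab).lt_or_eq with h' | h'
    · exact (this (fun x hx => (h x hx).symm) h').symm
    · exact h'.symm
  obtain ⟨x, hx⟩ := hne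
  obtain ⟨y, ⟨hyU, hy⟩, z, ⟨hzU, hz⟩, hyz⟩ := hA.exists_shift_iterate_ne
    (hU.inter (isOpen_setOf_agree x b)) ⟨x, hx, fun _ _ => rfl⟩ 0
  refine absurd (Subtype.ext (funext fun i => ?_)) hyz
  change y.1 i = z.1 i
  induction i using Nat.strong_induction_on with
  | _ i ih =>
    by_cases hi : i < b
    · rw [hy i hi, hz i hi]
    · have hback : ∀ u ∈ U, u.1 (i - b + a) = u.1 i := fun u hu => by
        have := congrArg (fun u : OneSided A => u.1 (i - b)) (h u hu)
        simpa only [shift_iterate_apply, Nat.sub_add_cancel (not_lt.1 hi)] using this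
      rw [← hback y hyU, ← hback z hzU, ih _ (by omega)]

/-- Every finite piece of a point is followed by a periodic point, whose period exceeds the
length of the piece by a bounded amount. -/
theorem exists_isPeriodicPt_agree (hA : IsTransitionMatrix A) :
    ∃ L, ∀ (x : OneSided A) (n : ℕ), ∃ (p : ℕ) (y : OneSided A), 0 < p ∧ n ≤ p ∧ p ≤ n + L ∧
      IsPeriodicPt (shift A) p y ∧ ∀ i ≤ n, y.1 i = x.1 i := by
  choose len hlen hpath using hA.exists_hasPath
  refine ⟨Finset.univ.sup fun i => Finset.univ.sup fun j => len i j, fun x n => ?_⟩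
  obtain ⟨w, hw0, hw1, hw⟩ := hpath (x.1 n) (x.1 0)
  have hL : len (x.1 n) (x.1 0) ≤ Finset.univ.sup fun i => Finset.univ.sup fun j => len i j :=
    (Finset.le_sup (f := fun j => len (x.1 n) j) (Finset.mem_univ (x.1 0))).trans
      (Finset.le_sup (f := fun i => Finset.univ.sup fun j => len i j) (Finset.mem_univ (x.1 n)))
  have hpos := hlen (x.1 n) (x.1 0)
  set l := len (x.1 n) (x.1 0)
  let c : ℕ → Fin N := fun i => if i ≤ n then x.1 i else w (i - n)
  have hc : ∀ i < n + l, A (c i) (c (i + 1)) = 1 := by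
    intro i hi
    rcases lt_trichotomy i n with h | rfl | h
    · simpa [c, h.le, Nat.succ_le_of_lt h] using x.2 i
    · simpa [c, hw0] using hw 0 hpos
    · have h1 : ¬ i ≤ n := by omega
      have h2 : ¬ i + 1 ≤ n := by omega
      simpa [c, h1, h2, show i + 1 - n = i - n + 1 by omega] using hw (i - n) (by omega)
  have hc0 : c (n + l) = c 0 := by
    have : ¬ n + l ≤ n := by omega
    simp [c, this, hw1]
  have hy : ∀ i, A (c (i % (n + l))) (c ((i + 1) % (n + l))) = 1 := by
    intro i
    have hlt : i % (n + l) < n + l := Nat.mod_lt _ (by omega)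
    have hstep := hc _ hlt
    rw [show (i + 1) % (n + l) = (i % (n + l) + 1) % (n + l) by simp]
    rcases (Nat.succ_le_of_lt hlt).lt_or_eq with h | h
    · rwa [Nat.mod_eq_of_lt (a := i % (n + l) + 1) h]
    · rw [Nat.succ_eq_add_one] at h
      rw [h] at hstep ⊢
      rwa [Nat.mod_self, ← hc0]
  refine ⟨n + l, ⟨fun i => c (i % (n + l)), hy⟩, by omega, by omega, by omega, ?_, fun i hi => ?_⟩
  · ext i
    rw [shift_iterate_apply]
    simp
  · simp [Nat.mod_eq_of_lt (show i < n + l by omega), c, hi]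

end IsTransitionMatrix

/-! ### Positivity of cohomology classes -/

theorem continuous_of_agree_imp_eq {Y : Type*} [TopologicalSpace Y] {f : OneSided A → Y} (m : ℕ)
    (h : ∀ x y : OneSided A, (∀ i < m, x.1 i = y.1 i) → f x = f y) : Continuous f :=
  ((IsLocallyConstant.iff_eventually_eq f).2 fun x =>
    Filter.mem_of_superset ((isOpen_setOf_agree x m).mem_nhds fun _ _ => rfl)
      fun y hy => h y x hy).continuous

theorem birkhoffSum_eq_of_agree {Y : Type*} [AddCommMonoid Y] {f : OneSided A → Y} {m : ℕ}
    (hm : ∀ x y : OneSided A, (∀ i < m, x.1 i = y.1 i) → f x = f y) {x y : OneSided A} {n : ℕ}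
    (h : ∀ i < n + m, x.1 i = y.1 i) :
    birkhoffSum (shift A) f n x = birkhoffSum (shift A) f n y := by
  refine Finset.sum_congr rfl fun k hk => hm _ _ fun i hi => ?_
  rw [shift_iterate_apply, shift_iterate_apply]
  exact h _ (by have := Finset.mem_range.1 hk; omega)

theorem exists_forall_abs_birkhoffSum_le (f : C(OneSided A, ℤ)) :
    ∃ K : ℕ, ∀ n x, |birkhoffSum (shift A) f n x| ≤ n * K := by
  obtain ⟨C, hC⟩ := isCompact_univ.exists_bound_of_continuousOn f.continuous.continuousOn
  refine ⟨⌈C⌉₊, fun n x => (Finset.abs_sum_le_sum_abs _ _).trans ?_⟩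
  refine (Finset.sum_le_card_nsmul _ _ (⌈C⌉₊ : ℤ) fun k _ => ?_).trans_eq (by simp)
  have h : ((|f ((shift A)^[k] x)| : ℤ) : ℝ) ≤ ⌈C⌉₊ := by
    simpa [Int.norm_eq_abs] using (hC ((shift A)^[k] x) (Set.mem_univ _)).trans (Nat.le_ceil C)
  exact_mod_cast h

theorem cls_add_coboundary (f ξ : C(OneSided A, ℤ)) :
    cls A (f + coboundary A ξ) = cls A f := by
  refine (QuotientAddGroup.eq.2 ?_).symm
  simp

namespace IsTransitionMatrix

theorem exists_le_birkhoffSum (hA : IsTransitionMatrix A) {f : C(OneSided A, ℤ)}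
    (hf : ∀ p > 0, ∀ y, IsPeriodicPt (shift A) p y → 0 ≤ birkhoffSum (shift A) f p y) :
    ∃ C, ∀ n x, C ≤ birkhoffSum (shift A) f n x := by
  obtain ⟨m, hm⟩ := exists_agree_imp_eq f.continuous
  obtain ⟨L, hL⟩ := hA.exists_isPeriodicPt_agree
  obtain ⟨K, hK⟩ := exists_forall_abs_birkhoffSum_le f
  refine ⟨-((m + L : ℕ) * K), fun n x => ?_⟩
  obtain ⟨p, y, hp, hnp, hpL, hy, hyx⟩ := hL x (n + m)
  have h0 := hf p hp y hy
  obtain ⟨r, rfl⟩ := Nat.exists_eq_add_of_le (show n ≤ p by omega)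
  rw [birkhoffSum_add, birkhoffSum_eq_of_agree hm fun i hi => hyx i hi.le] at h0
  have h1 := (abs_le.1 (hK r ((shift A)^[n] y))).2
  have h2 : (r : ℤ) * K ≤ (m + L : ℕ) * K :=
    mul_le_mul_of_nonneg_right (by exact_mod_cast (by omega : r ≤ m + L)) (by positivity)
  linarith

/-- A function whose sums over all periodic orbits are nonnegative is cohomologous to a
nonnegative function. -/
theorem cls_mem_positiveCone (hA : IsTransitionMatrix A) {f : C(OneSided A, ℤ)}
    (hf : ∀ p > 0, ∀ y, IsPeriodicPt (shift A) p y → 0 ≤ birkhoffSum (shift A) f p y) :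
    cls A f ∈ positiveCone A := by
  obtain ⟨C, hC⟩ := hA.exists_le_birkhoffSum hf
  obtain ⟨m, hm⟩ := exists_agree_imp_eq f.continuous
  let V : OneSided A → Set ℤ := fun x =>
    {s | ∃ n z, (shift A)^[n] z = x ∧ birkhoffSum (shift A) f n z = s}
  have hV : ∀ x y : OneSided A, (∀ i < m + 1, x.1 i = y.1 i) → V x ⊆ V y := by
    rintro x y hxy _ ⟨n, z, rfl, rfl⟩
    have h0 : y.1 0 = z.1 n := by rw [← hxy 0 (by omega), shift_iterate_apply, zero_add]
    refine ⟨n, glue z.1 n y (fun i _ => z.2 i) h0, shift_iterate_glue,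
      birkhoffSum_eq_of_agree hm fun i hi => ?_⟩
    rcases le_total i n with h | h
    · exact glue_apply h
    · obtain ⟨j, rfl⟩ := Nat.exists_eq_add_of_le' h
      rw [glue_apply_add, ← hxy j (by omega), shift_iterate_apply]
  let ξ : C(OneSided A, ℤ) := ⟨fun x => sInf (V x), continuous_of_agree_imp_eq (m + 1)
    fun x y hxy => congrArg sInf ((hV x y hxy).antisymm (hV y x fun i hi => (hxy i hi).symm))⟩
  have hbdd : ∀ x, BddBelow (V x) := fun x => ⟨C, by rintro _ ⟨n, z, -, rfl⟩; exact hC n z⟩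
  have hne : ∀ x, (V x).Nonempty := fun x => ⟨0, 0, x, rfl, birkhoffSum_zero _ _ _⟩
  refine ⟨f + coboundary A ξ, fun x => ?_, cls_add_coboundary f ξ⟩
  obtain ⟨n, z, hz, hs⟩ := Int.csInf_mem (hne x) (hbdd x)
  have h : ξ (shift A x) ≤ ξ x + f x := by
    refine csInf_le (hbdd _) ⟨n + 1, z, by rw [iterate_succ_apply', hz], ?_⟩
    rw [birkhoffSum_succ, hz, hs]
    rfl
  change 0 ≤ f x + (ξ x - ξ (shift A x))
  linarith

/-- A function whose sums over periodic orbits are bounded below by a positive multiple of the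
period represents an order unit. -/
theorem isOrderUnit_cls (hA : IsTransitionMatrix A) {u : C(OneSided A, ℤ)} {K : ℕ}
    (hu : ∀ p > 0, ∀ y, IsPeriodicPt (shift A) p y →
      (p : ℤ) ≤ K * birkhoffSum (shift A) u p y) :
    IsOrderUnit A (cls A u) := by
  refine ⟨hA.cls_mem_positiveCone fun p hp y hy => ?_, fun g => ?_⟩
  · have h : (0 : ℤ) < K * birkhoffSum (shift A) u p y :=
      lt_of_lt_of_le (by exact_mod_cast hp) (hu p hp y hy)
    exact (pos_of_mul_pos_right h (by positivity)).le
  · obtain ⟨g, rfl⟩ := QuotientAddGroup.mk_surjective g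
    obtain ⟨C, hC⟩ := exists_forall_abs_birkhoffSum_le g
    refine ⟨C * K, ?_⟩
    have : (C * K) • cls A u - QuotientAddGroup.mk g = cls A ((C * K) • u - g) := rfl
    rw [this]
    refine hA.cls_mem_positiveCone fun p hp y hy => ?_
    have h1 : birkhoffSum (shift A) ((C * K) • u - g : C(OneSided A, ℤ)) p y =
        (C * K : ℕ) * birkhoffSum (shift A) u p y - birkhoffSum (shift A) g p y := by
      simp [birkhoffSum, Finset.mul_sum]
    have h2 := (abs_le.1 (hC p y)).2
    have h3 := mul_le_mul_of_nonneg_left (hu p hp y hy) (Int.natCast_nonneg C)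
    rw [h1]
    push_cast
    linarith

end IsTransitionMatrix

/-! ### Tail equivalence -/

/-- Two points are tail equivalent if they lie on the same orbit of the one-sided shift. -/
def TailEquiv (x y : OneSided A) : Prop := ∃ m n : ℕ, (shift A)^[m] x = (shift A)^[n] y

namespace TailEquiv

theorem symm {x y : OneSided A} : TailEquiv x y → TailEquiv y x :=
  fun ⟨m, n, h⟩ => ⟨n, m, h.symm⟩

theorem trans {x y z : OneSided A} : TailEquiv x y → TailEquiv y z → TailEquiv x z := by
  rintro ⟨m, n, h⟩ ⟨m', n', h'⟩
  refine ⟨m' + m, n + n', ?_⟩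
  rw [iterate_add_apply, h, iterate_add_apply, ← h', ← iterate_add_apply, ← iterate_add_apply,
    add_comm]

theorem iterate (x : OneSided A) (n : ℕ) : TailEquiv x ((shift A)^[n] x) := ⟨n, 0, rfl⟩

theorem minimalPeriod_eq {x y : OneSided A} (h : TailEquiv x y) (hx : x ∈ periodicPts (shift A))
    (hy : y ∈ periodicPts (shift A)) : minimalPeriod (shift A) x = minimalPeriod (shift A) y := by
  obtain ⟨m, n, h⟩ := h
  rw [← minimalPeriod_apply_iterate hx m, h, minimalPeriod_apply_iterate hy]

end TailEquiv

theorem birkhoffSum_mul_of_isPeriodicPt {α : Type*} {f : α → α} {x : α} {q : ℕ}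
    (hx : IsPeriodicPt f q x) (g : α → ℤ) (b : ℕ) :
    birkhoffSum f g (q * b) x = b * birkhoffSum f g q x := by
  induction b with
  | zero => simp
  | succ b ih =>
    rw [Nat.mul_succ, birkhoffSum_add, ih, (hx.mul_const b).eq]
    push_cast
    ring

theorem birkhoffSum_cocycle (k l : C(OneSided A, ℕ)) (n : ℕ) (x : OneSided A) :
    birkhoffSum (shift A) (cocycle k l) n x =
      ((birkhoffSum (shift A) l n x : ℕ) : ℤ) - ((birkhoffSum (shift A) k n x : ℕ) : ℤ) := by
  simp [birkhoffSum, cocycle]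

theorem continuous_birkhoffSum_comp (g : C(OneSided B, ℕ)) (l : C(OneSided A, ℕ))
    {φ : OneSided A → OneSided B} (hφ : Continuous φ) :
    Continuous fun x => birkhoffSum (shift B) g (l x) (φ x) := by
  refine continuous_iff_continuousAt.2 fun x => ?_
  have h1 : Continuous fun y => birkhoffSum (shift B) g (l x) (φ y) :=
    continuous_finsetSum _ fun i _ => g.continuous.comp ((continuous_shift_iterate i).comp hφ)
  refine h1.continuousAt.congr ?_
  have h2 : ∀ᶠ y in 𝓝 x, l y = l x :=
    ((isOpen_discrete {l x}).preimage l.continuous).mem_nhds rfl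
  filter_upwards [h2] with y hy
  rw [hy]

namespace IsContinuousOrbitEquivalence

variable {h : OneSided A ≃ₜ OneSided B} {k₁ l₁ : C(OneSided A, ℕ)} {k₂ l₂ : C(OneSided B, ℕ)}

theorem symm (hh : IsContinuousOrbitEquivalence h k₁ l₁ k₂ l₂) :
    IsContinuousOrbitEquivalence h.symm k₂ l₂ k₁ l₁ :=
  ⟨hh.backward, hh.forward⟩

theorem iterate (hh : IsContinuousOrbitEquivalence h k₁ l₁ k₂ l₂) (n : ℕ) (x : OneSided A) :
    (shift B)^[birkhoffSum (shift A) k₁ n x] (h ((shift A)^[n] x)) =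
      (shift B)^[birkhoffSum (shift A) l₁ n x] (h x) := by
  induction n with
  | zero => simp
  | succ n ih =>
    rw [birkhoffSum_succ, birkhoffSum_succ, iterate_succ_apply', iterate_add_apply, hh.forward,
      ← iterate_add_apply, add_comm, iterate_add_apply, ih, ← iterate_add_apply, add_comm]

theorem tailEquiv (hh : IsContinuousOrbitEquivalence h k₁ l₁ k₂ l₂) {x y : OneSided A}
    (hxy : TailEquiv x y) : TailEquiv (h x) (h y) := by
  have key : ∀ (n : ℕ) (x : OneSided A), TailEquiv (h x) (h ((shift A)^[n] x)) :=
    fun n x => ⟨_, _, (hh.iterate n x).symm⟩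
  obtain ⟨m, n, hmn⟩ := hxy
  exact (key m x).trans (hmn ▸ (key n y).symm)

/-- Pulling back a function along the orbit equivalence, at the level of sums along orbits. -/
theorem birkhoffSum_transfer (hh : IsContinuousOrbitEquivalence h k₁ l₁ k₂ l₂)
    (g : OneSided B → ℤ) (n : ℕ) (x : OneSided A) :
    birkhoffSum (shift A) (fun x => birkhoffSum (shift B) g (l₁ x) (h x) -
        birkhoffSum (shift B) g (k₁ x) (h (shift A x))) n x =
      birkhoffSum (shift B) g (birkhoffSum (shift A) l₁ n x) (h x) -
        birkhoffSum (shift B) g (birkhoffSum (shift A) k₁ n x) (h ((shift A)^[n] x)) := by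
  induction n with
  | zero => simp
  | succ n ih =>
    rw [birkhoffSum_succ, ih, birkhoffSum_succ, birkhoffSum_succ, iterate_succ_apply']
    set y := (shift A)^[n] x with hy
    set K := birkhoffSum (shift A) k₁ n x with hK
    have e1 := birkhoffSum_add (shift B) g (birkhoffSum (shift A) l₁ n x) (l₁ y) (h x)
    rw [← hh.iterate n x, ← hy, ← hK] at e1
    have e2 := birkhoffSum_add (shift B) g K (l₁ y) (h y)
    have e3 := birkhoffSum_add (shift B) g (l₁ y) K (h y)
    rw [← hh.forward y, add_comm (l₁ y)] at e3
    have e4 := birkhoffSum_add (shift B) g (k₁ y) K (h (shift A y))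
    rw [add_comm (k₁ y)] at e4
    linarith

theorem transfer_cocycle (hh : IsContinuousOrbitEquivalence h k₁ l₁ k₂ l₂)
    (hA : IsTransitionMatrix A) (x : OneSided A) :
    birkhoffSum (shift B) (cocycle k₂ l₂) (l₁ x) (h x) -
      birkhoffSum (shift B) (cocycle k₂ l₂) (k₁ x) (h (shift A x)) = 1 := by
  let a : OneSided A → ℕ := fun x => birkhoffSum (shift B) k₂ (k₁ x) (h (shift A x)) +
    birkhoffSum (shift B) l₂ (l₁ x) (h x)
  let b : OneSided A → ℕ := fun x => birkhoffSum (shift B) k₂ (l₁ x) (h x) +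
    birkhoffSum (shift B) l₂ (k₁ x) (h (shift A x))
  have ha : Continuous a :=
    (continuous_birkhoffSum_comp _ _ (h.continuous.comp (shift A).continuous)).add
      (continuous_birkhoffSum_comp _ _ h.continuous)
  have hb : Continuous b := (continuous_birkhoffSum_comp _ _ h.continuous).add
    (continuous_birkhoffSum_comp _ _ (h.continuous.comp (shift A).continuous))
  have hab : ∀ x, (shift A)^[a x] x = (shift A)^[b x + 1] x := by
    intro x
    have h1 := hh.symm.iterate (l₁ x) (h x)
    have h2 := hh.symm.iterate (k₁ x) (h (shift A x))
    rw [h.symm_apply_apply] at h1 h2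
    rw [hh.forward] at h2
    rw [iterate_add_apply, ← h1, ← iterate_add_apply, add_comm, iterate_add_apply, h2,
      ← iterate_add_apply, iterate_succ_apply]
  have hU : IsOpen {y | a y = a x ∧ b y = b x} :=
    ((isOpen_discrete {a x}).preimage ha).inter ((isOpen_discrete {b x}).preimage hb)
  have h1 : a x = b x + 1 := hA.eq_of_shift_iterate_eq hU ⟨x, rfl, rfl⟩ fun y ⟨hya, hyb⟩ => by
    rw [← hya, ← hyb, hab]
  have h2 : ((a x : ℕ) : ℤ) = b x + 1 := by exact_mod_cast h1
  simp only [a, b, Nat.cast_add] at h2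
  rw [birkhoffSum_cocycle, birkhoffSum_cocycle]
  linarith

/-- The cocycle of an orbit equivalence is nonnegative along periodic orbits: the inverse
branch of the shift at a periodic point is contracting, and so is its image. -/
theorem birkhoffSum_le (hh : IsContinuousOrbitEquivalence h k₁ l₁ k₂ l₂)
    (hB : IsTransitionMatrix B) {x : OneSided A} {p : ℕ} (hp : 0 < p)
    (hx : IsPeriodicPt (shift A) p x) :
    birkhoffSum (shift A) k₁ p x ≤ birkhoffSum (shift A) l₁ p x := by
  by_contra! hlt
  obtain ⟨d, hd⟩ := Nat.exists_eq_add_of_le hlt.le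
  have hd0 : 0 < d := by omega
  set l := birkhoffSum (shift A) l₁ p x with hl
  obtain ⟨m₁, hm₁⟩ := exists_agree_imp_eq k₁.continuous
  obtain ⟨m₂, hm₂⟩ := exists_agree_imp_eq l₁.continuous
  have hxp : ∀ i, x.1 (i + p) = x.1 i := fun i => by
    rw [← shift_iterate_apply, hx.eq]
  set m := max m₁ m₂ + 1 with hm
  have key : ∀ z : OneSided A, (∀ i < m, z.1 i = x.1 i) → ∀ n, ∃ w : OneSided A,
      (∀ i < n * p + m, w.1 i = x.1 i) ∧
      (shift B)^[l + n * d] (h z) = (shift B)^[l] (h w) := by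
    intro z hz n
    induction n with
    | zero => exact ⟨z, by simpa using hz, by simp⟩
    | succ n ih =>
      obtain ⟨w, hw, hwz⟩ := ih
      have h0 : w.1 0 = x.1 p := by
        rw [hw 0 (by omega), ← hxp 0, zero_add]
      let v := glue x.1 p w (fun i _ => x.2 i) h0
      have hv : ∀ i < (n + 1) * p + m, v.1 i = x.1 i := by
        intro i hi
        rcases le_total i p with hip | hip
        · exact glue_apply hip
        · obtain ⟨j, rfl⟩ := Nat.exists_eq_add_of_le' hip
          rw [glue_apply_add, hxp]
          exact hw j (by rw [Nat.succ_mul] at hi; omega)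
      have hpm : p + m ≤ (n + 1) * p + m := by
        rw [Nat.succ_mul]
        omega
      have hkv := birkhoffSum_eq_of_agree hm₁ (x := v) (y := x) (n := p)
        fun i hi => hv i (by omega)
      have hlv := birkhoffSum_eq_of_agree hm₂ (x := v) (y := x) (n := p)
        fun i hi => hv i (by omega)
      have hit := hh.iterate p v
      rw [hkv, hlv, shift_iterate_glue, hd, ← hl] at hit
      refine ⟨v, hv, ?_⟩
      rw [Nat.succ_mul, ← add_assoc, add_comm, iterate_add_apply, hwz, ← iterate_add_apply,
        add_comm, hit]
  obtain ⟨R, hR⟩ := exists_agree_subset (x := x)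
    ((isOpen_setOf_agree (h x) (l + d)).preimage h.continuous) (fun _ _ => rfl)
  have hcoord : ∀ z : OneSided A, (∀ i < m, z.1 i = x.1 i) → ∀ i,
      ((shift B)^[l + R * d] (h z)).1 i = (h x).1 (i % d + l) := by
    intro z hz i
    obtain ⟨w, hw, hwz⟩ := key z hz (R + i / d)
    have hRp : R ≤ (R + i / d) * p :=
      (Nat.le_add_right _ _).trans (Nat.le_mul_of_pos_right _ hp)
    have hlt := Nat.mod_lt i hd0
    have h1 := hR w (fun j hj => hw j (by omega)) (i % d + l) (by omega)
    have h2 := congrArg (fun u : OneSided B => u.1 (i % d)) hwz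
    simp only [shift_iterate_apply] at h2
    rw [← h1, ← h2, shift_iterate_apply]
    refine congrArg (h z).1 ?_
    have := Nat.mod_add_div i d
    rw [add_mul, mul_comm (i / d)]
    omega
  obtain ⟨y, hy, z, hz, hyz⟩ := hB.exists_shift_iterate_ne
    ((isOpen_setOf_agree x m).preimage h.symm.continuous)
    ⟨h x, by simp⟩ (l + R * d)
  refine hyz (Subtype.ext (funext fun i => ?_))
  have h1 := hcoord _ hy i
  have h2 := hcoord _ hz i
  rw [h.apply_symm_apply] at h1 h2
  rw [h1, h2]

theorem exists_isPeriodicPt (hh : IsContinuousOrbitEquivalence h k₁ l₁ k₂ l₂)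
    (hA : IsTransitionMatrix A) (hB : IsTransitionMatrix B) {x : OneSided A} {p : ℕ} (hp : 0 < p)
    (hx : IsPeriodicPt (shift A) p x) :
    ∃ y r, 0 < r ∧ TailEquiv (h x) y ∧ IsPeriodicPt (shift B) r y ∧
      birkhoffSum (shift A) (cocycle k₁ l₁) p x = r ∧
      birkhoffSum (shift B) (cocycle k₂ l₂) r y = p := by
  obtain ⟨r, hr⟩ := Nat.exists_eq_add_of_le (hh.birkhoffSum_le hB hp hx)
  have hit := hh.iterate p x
  have htr := hh.birkhoffSum_transfer (cocycle k₂ l₂) p x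
  simp only [hh.transfer_cocycle hA] at htr
  rw [hx.eq] at hit htr
  rw [hr, birkhoffSum_add, add_sub_cancel_left] at htr
  have hsum : birkhoffSum (shift B) (cocycle k₂ l₂) r
      ((shift B)^[birkhoffSum (shift A) k₁ p x] (h x)) = p := by
    rw [← htr]
    simp [birkhoffSum]
  refine ⟨_, r, ?_, .iterate _ _, ?_, ?_, hsum⟩
  · rcases Nat.eq_zero_or_pos r with rfl | h0
    · rw [birkhoffSum_zero] at hsum
      omega
    · exact h0
  · rw [IsPeriodicPt, IsFixedPt, ← iterate_add_apply, add_comm, ← hr, hit]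
  · rw [birkhoffSum_cocycle, hr]
    push_cast
    ring

/-- The sum of the cocycle over a periodic orbit is the length of the corresponding periodic
orbit of the other shift. -/
theorem birkhoffSum_cocycle_eq_minimalPeriod
    (hh : IsContinuousOrbitEquivalence h k₁ l₁ k₂ l₂)
    (hA : IsTransitionMatrix A) (hB : IsTransitionMatrix B) {x : OneSided A} {y : OneSided B}
    (hx : x ∈ periodicPts (shift A)) (hy : y ∈ periodicPts (shift B))
    (hxy : TailEquiv (h x) y) :
    birkhoffSum (shift A) (cocycle k₁ l₁) (minimalPeriod (shift A) x) x =
      minimalPeriod (shift B) y := by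
  obtain ⟨z, r, hr, hxz, hz, h1, h2⟩ := hh.exists_isPeriodicPt hA hB
    (minimalPeriod_pos_of_mem_periodicPts hx) (isPeriodicPt_minimalPeriod (shift A) x)
  have hz' : z ∈ periodicPts (shift B) := mk_mem_periodicPts hr hz
  obtain ⟨w, s, hs, hzw, hw, h3, -⟩ := hh.symm.exists_isPeriodicPt hB hA
    (minimalPeriod_pos_of_mem_periodicPts hz') (isPeriodicPt_minimalPeriod (shift B) z)
  have hxw : TailEquiv x w := by
    have := hh.symm.tailEquiv hxz
    rw [h.symm_apply_apply] at this
    exact this.trans hzw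
  have hps : minimalPeriod (shift A) x ≤ s := by
    rw [hxw.minimalPeriod_eq hx (mk_mem_periodicPts hs hw)]
    exact hw.minimalPeriod_le hs
  obtain ⟨b, rfl⟩ := hz.minimalPeriod_dvd
  rw [birkhoffSum_mul_of_isPeriodicPt (isPeriodicPt_minimalPeriod _ _), h3] at h2
  have hb : b ≤ 1 := by
    have h4 : b * s = minimalPeriod (shift A) x := by exact_mod_cast h2
    exact Nat.le_of_mul_le_mul_right (by omega) hs
  have hb' : b = 1 := by
    have := pos_of_mul_pos_right hr (Nat.zero_le _)
    omega
  rw [h1, hb', mul_one, (hxz.symm.trans hxy).minimalPeriod_eq hz' hy]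

end IsContinuousOrbitEquivalence

/-! ### Periodic points of the one-sided and of the two-sided shift -/

theorem mem_Per_iff {p : ℕ} {x : TwoSided A} : x ∈ Per A p ↔ IsPeriodicPt (shiftTwo A) p x := by
  rw [IsPeriodicPt, IsFixedPt, Equiv.Perm.iterate_eq_pow]
  rfl

theorem restrict_iterate (n : ℕ) (x : TwoSided A) :
    restrict A ((shiftTwo A)^[n] x) = (shift A)^[n] (restrict A x) :=
  Semiconj.iterate_right (f := restrict A) (restrict_shiftTwo A) n x

theorem shiftTwo_iterate_apply (x : TwoSided A) (n : ℕ) (i : ℤ) :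
    ((shiftTwo A)^[n] x).1 i = x.1 (i + n) := by
  induction n generalizing x with
  | zero => simp
  | succ n ih =>
    rw [iterate_succ_apply, ih, Nat.cast_succ, ← add_assoc]
    rfl

theorem eq_of_restrict_eq {x y : TwoSided A} (hx : x ∈ periodicPts (shiftTwo A))
    (hy : y ∈ periodicPts (shiftTwo A)) (h : restrict A x = restrict A y) : x = y := by
  obtain ⟨p, hp, hxp⟩ := hx
  obtain ⟨q, hq, hyq⟩ := hy
  have hpq : 0 < p * q := Nat.mul_pos hp hq
  ext1
  funext n
  have h1 := congrArg (fun u : TwoSided A => u.1 n) ((hxp.mul_const q).mul_const n.natAbs).eq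
  have h2 := congrArg (fun u : TwoSided A => u.1 n) ((hyq.const_mul p).mul_const n.natAbs).eq
  simp only [shiftTwo_iterate_apply] at h1 h2
  have hn : 0 ≤ n + ((p * q * n.natAbs : ℕ) : ℤ) := by
    have : n.natAbs ≤ p * q * n.natAbs := Nat.le_mul_of_pos_left _ hpq
    omega
  obtain ⟨k, hk⟩ := Int.eq_ofNat_of_zero_le hn
  rw [hk] at h1 h2
  rw [← h1, ← h2]
  exact congrArg (fun u : OneSided A => u.1 k) h

theorem restrict_mem_periodicPts {x : TwoSided A} (hx : x ∈ periodicPts (shiftTwo A)) :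
    restrict A x ∈ periodicPts (shift A) :=
  Semiconj.mapsTo_periodicPts (g := restrict A) (restrict_shiftTwo A) hx

theorem minimalPeriod_restrict {x : TwoSided A} (hx : x ∈ periodicPts (shiftTwo A)) :
    minimalPeriod (shift A) (restrict A x) = minimalPeriod (shiftTwo A) x := by
  refine minimalPeriod_eq_minimalPeriod_iff.2 fun n => ⟨fun h => ?_, fun h => ?_⟩
  · refine eq_of_restrict_eq ?_ hx ?_
    · obtain ⟨p, hp, hxp⟩ := hx
      exact ⟨p, hp, hxp.apply_iterate n⟩
    · rw [restrict_iterate]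
      exact h
  · exact h.map (g := restrict A) (restrict_shiftTwo A)

theorem apply_mod_of_isPeriodicPt {y : OneSided A} {p : ℕ} (hy : IsPeriodicPt (shift A) p y)
    (i : ℕ) : y.1 (i % p) = y.1 i := by
  conv_rhs => rw [← Nat.mod_add_div i p, ← shift_iterate_apply, (hy.mul_const _).eq]

theorem exists_restrict_eq {y : OneSided A} (hy : y ∈ periodicPts (shift A)) :
    ∃ x ∈ periodicPts (shiftTwo A), restrict A x = y := by
  obtain ⟨p, hp, hyp⟩ := hy
  have hp0 : (p : ℤ) ≠ 0 := by omega
  have hmod : ∀ (n : ℤ) (k : ℕ), (k : ℤ) % p = n % p → y.1 (n % p).toNat = y.1 k := by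
    intro n k hk
    rw [← hk, ← Int.natCast_mod, Int.toNat_natCast, apply_mod_of_isPeriodicPt hyp]
  refine ⟨⟨fun n => y.1 (n % p).toNat, fun n => ?_⟩, ⟨p, hp, ?_⟩, ?_⟩
  · have h0 : (((n % p).toNat : ℕ) : ℤ) = n % p := Int.toNat_of_nonneg (Int.emod_nonneg _ hp0)
    have h1 : y.1 ((n + 1) % p).toNat = y.1 ((n % p).toNat + 1) :=
      hmod _ _ (by rw [Nat.cast_succ, h0, Int.emod_add_emod])
    exact (congrArg (A _) h1).trans (y.2 _)
  · ext1
    funext n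
    rw [shiftTwo_iterate_apply]
    simp
  · ext1
    funext n
    exact hmod n n rfl

/-! ### Periodic orbits -/

namespace PeriodicOrbit

theorem ext {γ δ : PeriodicOrbit A} (h : γ.1 = δ.1) : γ = δ := Subtype.ext h

theorem nonempty (γ : PeriodicOrbit A) : γ.1.Nonempty := by
  obtain ⟨_, x, -, rfl⟩ := γ
  exact ⟨_, 0, rfl⟩

theorem mem_periodicPts (γ : PeriodicOrbit A) {x : TwoSided A} (hx : x ∈ γ.1) :
    x ∈ periodicPts (shiftTwo A) := by
  obtain ⟨_, x, ⟨p, hp, hp'⟩, rfl⟩ := γ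
  obtain ⟨n, rfl⟩ := hx
  refine ⟨p, hp, mem_Per_iff.1 ?_⟩
  change (shiftTwo A ^ p) ((shiftTwo A ^ n) x) = (shiftTwo A ^ n) x
  rw [← Equiv.Perm.mul_apply, ← zpow_natCast, zpow_mul_comm, Equiv.Perm.mul_apply, zpow_natCast,
    show (shiftTwo A ^ p) x = x from hp']

theorem eq_range_zpow (γ : PeriodicOrbit A) {x : TwoSided A} (hx : x ∈ γ.1) :
    γ.1 = Set.range fun n : ℤ => (shiftTwo A ^ n) x := by
  obtain ⟨_, x, _, rfl⟩ := γ
  obtain ⟨n, rfl⟩ := hx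
  ext y
  constructor
  · rintro ⟨m, rfl⟩
    exact ⟨m - n, by simp [← Equiv.Perm.mul_apply, ← zpow_add]⟩
  · rintro ⟨m, rfl⟩
    exact ⟨m + n, by simp [zpow_add]⟩

theorem iterate_mem (γ : PeriodicOrbit A) {x : TwoSided A} (hx : x ∈ γ.1) (n : ℕ) :
    (shiftTwo A)^[n] x ∈ γ.1 := γ.bijOn.mapsTo.iterate n hx

theorem eq_of_mem {γ δ : PeriodicOrbit A} {x : TwoSided A} (hγ : x ∈ γ.1) (hδ : x ∈ δ.1) :
    γ = δ :=
  ext ((γ.eq_range_zpow hγ).trans (δ.eq_range_zpow hδ).symm)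

theorem exists_mem {x : TwoSided A} (hx : x ∈ periodicPts (shiftTwo A)) :
    ∃ γ : PeriodicOrbit A, x ∈ γ.1 := by
  obtain ⟨p, hp, hx⟩ := hx
  exact ⟨⟨_, x, ⟨p, hp, mem_Per_iff.2 hx⟩, rfl⟩, 0, rfl⟩

theorem bijOn_iterate (γ : PeriodicOrbit A) {x : TwoSided A} (hx : x ∈ γ.1) :
    Set.BijOn (fun i => (shiftTwo A)^[i] x) (Finset.range (minimalPeriod (shiftTwo A) x)) γ.1 := by
  refine ⟨fun i _ => γ.iterate_mem hx i, ?_, fun y hy => ?_⟩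
  · simpa [Set.Iio] using iterate_injOn_Iio_minimalPeriod (f := shiftTwo A) (x := x)
  · rw [γ.eq_range_zpow hx] at hy
    obtain ⟨n, rfl⟩ := hy
    have hp := minimalPeriod_pos_of_mem_periodicPts (γ.mem_periodicPts hx)
    set p := minimalPeriod (shiftTwo A) x with hpdef
    have hp0 : (p : ℤ) ≠ 0 := by omega
    have hlt := Int.emod_lt_of_pos n (show (0 : ℤ) < p by omega)
    have h0 : (((n % p).toNat : ℕ) : ℤ) = n % p := Int.toNat_of_nonneg (Int.emod_nonneg _ hp0)
    refine ⟨(n % p).toNat, by simp only [Finset.coe_range, Set.mem_Iio]; omega, ?_⟩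
    have hx' : (shiftTwo A ^ ((p : ℤ) * (n / p))) x = x := by
      rw [zpow_mul]
      refine IsFixedPt.perm_zpow (e := shiftTwo A ^ (p : ℤ)) ?_ _
      rw [zpow_natCast]
      exact mem_Per_iff.2 (isPeriodicPt_minimalPeriod _ _)
    change (shiftTwo A)^[(n % p).toNat] x = (shiftTwo A ^ n) x
    rw [Equiv.Perm.iterate_eq_pow, ← zpow_natCast, h0]
    conv_rhs => rw [← Int.emod_add_mul_ediv n p, zpow_add, Equiv.Perm.mul_apply, hx']

theorem ncard_eq (γ : PeriodicOrbit A) {x : TwoSided A} (hx : x ∈ γ.1) :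
    γ.1.ncard = minimalPeriod (shiftTwo A) x := by
  have h := γ.bijOn_iterate hx
  rw [← h.image_eq, h.injOn.ncard_image, Set.ncard_coe_finset, Finset.card_range]

theorem ncard_pos (γ : PeriodicOrbit A) : 0 < γ.1.ncard :=
  (Set.ncard_pos γ.finite).2 γ.nonempty

theorem orbitSum_eq (γ : PeriodicOrbit A) {x : TwoSided A} (hx : x ∈ γ.1)
    (f : C(OneSided A, ℤ)) :
    orbitSum γ f = birkhoffSum (shift A) f (minimalPeriod (shift A) (restrict A x))
      (restrict A x) := by
  rw [minimalPeriod_restrict (γ.mem_periodicPts hx)]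
  change ∑ᶠ x ∈ γ.1, f (restrict A x) = _
  rw [← finsum_mem_eq_of_bijOn (f := fun i => f (restrict A ((shiftTwo A)^[i] x))) _
    (γ.bijOn_iterate hx) fun _ _ => rfl, finsum_mem_coe_finset]
  simp only [restrict_iterate]
  rfl

theorem tailEquiv (γ : PeriodicOrbit A) {x y : TwoSided A} (hx : x ∈ γ.1) (hy : y ∈ γ.1) :
    TailEquiv (restrict A x) (restrict A y) := by
  obtain ⟨n, -, rfl⟩ := (γ.bijOn_iterate hx).surjOn hy
  exact ⟨n, 0, (restrict_iterate n x).symm⟩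

theorem eq_of_tailEquiv {γ δ : PeriodicOrbit A} {x y : TwoSided A} (hx : x ∈ γ.1) (hy : y ∈ δ.1)
    (h : TailEquiv (restrict A x) (restrict A y)) : γ = δ := by
  obtain ⟨m, n, h⟩ := h
  rw [← restrict_iterate, ← restrict_iterate] at h
  have hm := γ.iterate_mem hx m
  have hn := δ.iterate_mem hy n
  rw [eq_of_restrict_eq (γ.mem_periodicPts hm) (δ.mem_periodicPts hn) h] at hm
  exact eq_of_mem hm hn

end PeriodicOrbit

namespace IsContinuousOrbitEquivalence

variable {h : OneSided A ≃ₜ OneSided B} {k₁ l₁ : C(OneSided A, ℕ)} {k₂ l₂ : C(OneSided B, ℕ)}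

theorem isOrderUnit (hh : IsContinuousOrbitEquivalence h k₁ l₁ k₂ l₂)
    (hA : IsTransitionMatrix A) (hB : IsTransitionMatrix B) :
    IsOrderUnit A (cls A (cocycle k₁ l₁)) := by
  obtain ⟨K, hK⟩ := exists_forall_abs_birkhoffSum_le (cocycle k₂ l₂)
  refine hA.isOrderUnit_cls (K := K) fun p hp x hx => ?_
  obtain ⟨y, r, -, -, -, h1, h2⟩ := hh.exists_isPeriodicPt hA hB hp hx
  rw [h1, ← h2, mul_comm]
  exact (abs_le.1 (hK r y)).2

/-- A continuous orbit equivalence induces a bijection of the periodic orbits, under which the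
sum of the cocycle over an orbit is the length of the corresponding orbit. -/
theorem exists_periodicOrbit_equiv (hh : IsContinuousOrbitEquivalence h k₁ l₁ k₂ l₂)
    (hA : IsTransitionMatrix A) (hB : IsTransitionMatrix B) :
    ∃ Φ : PeriodicOrbit A ≃ PeriodicOrbit B,
      ∀ γ, beta γ (cls A (cocycle k₁ l₁)) = (Φ γ).1.ncard := by
  have hex : ∀ γ : PeriodicOrbit A, ∃ δ : PeriodicOrbit B, ∀ x ∈ γ.1, ∀ y ∈ δ.1,
      TailEquiv (h (restrict A x)) (restrict B y) := by
    intro γ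
    obtain ⟨x, hx⟩ := γ.nonempty
    obtain ⟨p, hp, hxp⟩ := restrict_mem_periodicPts (γ.mem_periodicPts hx)
    obtain ⟨z, r, hr, hxz, hz, -, -⟩ := hh.exists_isPeriodicPt hA hB hp hxp
    obtain ⟨y, hy, rfl⟩ := exists_restrict_eq (mk_mem_periodicPts hr hz)
    obtain ⟨δ, hδ⟩ := PeriodicOrbit.exists_mem hy
    exact ⟨δ, fun x' hx' y' hy' =>
      ((hh.tailEquiv (γ.tailEquiv hx' hx)).trans hxz).trans (δ.tailEquiv hδ hy')⟩
  choose Φ hΦ using hex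
  have hbij : Bijective Φ := by
    constructor
    · intro γ γ' hγ
      obtain ⟨x, hx⟩ := γ.nonempty
      obtain ⟨x', hx'⟩ := γ'.nonempty
      obtain ⟨y, hy⟩ := (Φ γ).nonempty
      have h1 := hh.symm.tailEquiv
        ((hΦ γ x hx y hy).trans (hΦ γ' x' hx' y (hγ ▸ hy)).symm)
      rw [h.symm_apply_apply, h.symm_apply_apply] at h1
      exact PeriodicOrbit.eq_of_tailEquiv hx hx' h1
    · intro δ
      obtain ⟨y, hy⟩ := δ.nonempty
      obtain ⟨q, hq, hyq⟩ := restrict_mem_periodicPts (δ.mem_periodicPts hy)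
      obtain ⟨z, r, hr, hyz, hz, -, -⟩ := hh.symm.exists_isPeriodicPt hB hA hq hyq
      obtain ⟨x, hx, rfl⟩ := exists_restrict_eq (mk_mem_periodicPts hr hz)
      obtain ⟨γ, hγ⟩ := PeriodicOrbit.exists_mem hx
      obtain ⟨y', hy'⟩ := (Φ γ).nonempty
      refine ⟨γ, PeriodicOrbit.eq_of_tailEquiv hy' hy ?_⟩
      have h1 := hh.tailEquiv hyz
      rw [h.apply_symm_apply] at h1
      exact (h1.trans (hΦ γ x hγ y' hy')).symm
  refine ⟨Equiv.ofBijective Φ hbij, fun γ => ?_⟩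
  obtain ⟨x, hx⟩ := γ.nonempty
  obtain ⟨y, hy⟩ := (Φ γ).nonempty
  have hy' := (Φ γ).mem_periodicPts hy
  change orbitSum γ (cocycle k₁ l₁) = ((Φ γ).1.ncard : ℤ)
  rw [γ.orbitSum_eq hx, (Φ γ).ncard_eq hy, ← minimalPeriod_restrict hy']
  exact hh.birkhoffSum_cocycle_eq_minimalPeriod hA hB
    (restrict_mem_periodicPts (γ.mem_periodicPts hx)) (restrict_mem_periodicPts hy')
    (hΦ γ x hx y hy)

end IsContinuousOrbitEquivalence

/-! ### Counting periodic points -/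

/-- A point of period `p` is determined by its coordinates `0, …, p - 1`. -/
theorem injective_periodicWord {p : ℕ} (hp : 0 < p) :
    Injective fun (x : Per A p) (i : Fin p) => x.1.1 i := by
  rintro ⟨x, hx⟩ ⟨y, hy⟩ hxy
  rw [mem_Per_iff] at hx hy
  have hword : ∀ {z : TwoSided A}, IsPeriodicPt (shiftTwo A) p z → ∀ i : ℕ,
      (restrict A z).1 i = z.1 (i % p : ℕ) := fun hz i =>
    (apply_mod_of_isPeriodicPt (hz.map (g := restrict A) (restrict_shiftTwo A)) i).symm
  refine Subtype.ext (eq_of_restrict_eq (mk_mem_periodicPts hp hx) (mk_mem_periodicPts hp hy) ?_)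
  ext1
  funext i
  rw [hword hx, hword hy]
  exact congrFun hxy ⟨i % p, Nat.mod_lt i hp⟩

theorem finite_Per {p : ℕ} (hp : 0 < p) : Finite (Per A p) :=
  Finite.of_injective _ (injective_periodicWord hp)

theorem ncard_Per_le {p : ℕ} (hp : 0 < p) : (Per A p).ncard ≤ N ^ p := by
  rw [← Nat.card_coe_set_eq]
  refine (Nat.card_le_card_of_injective _ (injective_periodicWord hp)).trans_eq ?_
  simp

theorem eventually_zetaConverges (A : Matrix (Fin N) (Fin N) ℤ) :
    ∀ᶠ t in 𝓝 (0 : ℂ), ZetaConverges A t := by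
  have hr : (0 : ℝ) < 1 / (N + 1) := by positivity
  filter_upwards [Metric.ball_mem_nhds (0 : ℂ) hr] with t ht
  rw [mem_ball_zero_iff, lt_div_iff₀ (by positivity)] at ht
  have hgeom := (summable_nat_add_iff 1).2
    (summable_geometric_of_lt_one (by positivity : 0 ≤ ‖t‖ * (N + 1)) ht)
  refine Summable.of_norm_bounded hgeom fun n => ?_
  have h1 : ((Per A (n + 1)).ncard : ℝ) ≤ (N + 1 : ℝ) ^ (n + 1) := by
    refine le_trans (b := ((N ^ (n + 1) : ℕ) : ℝ)) (by exact_mod_cast ncard_Per_le n.succ_pos) ?_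
    push_cast
    gcongr
    linarith
  rw [norm_mul, norm_div, norm_pow, Complex.norm_natCast, Complex.norm_natCast, mul_pow]
  refine mul_le_mul (div_le_self (by positivity) ?_) h1 (by positivity) (by positivity)
  exact_mod_cast n.succ_pos

theorem IsTransitionMatrix.nonempty_periodicOrbit (hA : IsTransitionMatrix A) :
    Nonempty (PeriodicOrbit A) := by
  obtain ⟨x, -⟩ := hA.exists_point ⟨0, one_pos.trans hA.one_lt⟩
  obtain ⟨L, hL⟩ := hA.exists_isPeriodicPt_agree
  obtain ⟨p, y, hp, -, -, hy, -⟩ := hL x 0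
  obtain ⟨z, hz, -⟩ := exists_restrict_eq (mk_mem_periodicPts hp hy)
  obtain ⟨γ, -⟩ := PeriodicOrbit.exists_mem hz
  exact ⟨γ⟩

/-! ### The Euler product of the zeta function -/

theorem hasSum_prod_snd {α 𝕜 : Type*} [Finite α] [RCLike 𝕜] {g : ℕ → 𝕜} {s : 𝕜}
    (hg : Summable fun k => ‖g k‖) (hs : HasSum g s) :
    HasSum (fun p : α × ℕ => g p.2) (Nat.card α * s) := by
  have h1 : Summable fun _ : α => ‖(1 : 𝕜)‖ := Summable.of_finite
  have h2 := (summable_mul_of_summable_norm h1 hg).hasSum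
  rw [← tsum_mul_tsum_of_summable_norm h1 hg, hs.tsum_eq, tsum_const] at h2
  simpa using h2

variable (A) in
/-- The periodic points together with their periods, grouped by the period, respectively by the
orbit. -/
noncomputable def orbitPeriods (q : Σ γ : PeriodicOrbit A, γ.1 × ℕ) : Σ n : ℕ, Per A (n + 1) :=
  ⟨q.1.1.ncard * (q.2.2 + 1) - 1, q.2.1.1, by
    rw [Nat.sub_add_cancel (Nat.mul_pos q.1.ncard_pos q.2.2.succ_pos), mem_Per_iff,
      q.1.ncard_eq q.2.1.2]
    exact (isPeriodicPt_minimalPeriod _ _).mul_const _⟩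

theorem orbitPeriods_fst (q : Σ γ : PeriodicOrbit A, γ.1 × ℕ) :
    (orbitPeriods A q).1 + 1 = q.1.1.ncard * (q.2.2 + 1) :=
  Nat.sub_add_cancel (Nat.mul_pos q.1.ncard_pos q.2.2.succ_pos)

theorem bijective_orbitPeriods : Bijective (orbitPeriods A) := by
  constructor
  · rintro ⟨γ, ⟨x, hx⟩, k⟩ ⟨δ, ⟨y, hy⟩, l⟩ h
    have h1 : x = y := congrArg (fun s : Σ n : ℕ, Per A (n + 1) => (s.2 : TwoSided A)) h
    subst h1
    obtain rfl := PeriodicOrbit.eq_of_mem hx hy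
    have h2 := congrArg (fun s : Σ n : ℕ, Per A (n + 1) => s.1 + 1) h
    simp only [orbitPeriods_fst] at h2
    have h3 := Nat.eq_of_mul_eq_mul_left γ.ncard_pos h2
    obtain rfl : k = l := by omega
    rfl
  · rintro ⟨n, x, hx⟩
    have hx' := mem_Per_iff.1 hx
    obtain ⟨γ, hγ⟩ := PeriodicOrbit.exists_mem (mk_mem_periodicPts n.succ_pos hx')
    obtain ⟨k, hk⟩ := hx'.minimalPeriod_dvd
    rw [← γ.ncard_eq hγ] at hk
    have hk0 : 0 < k := Nat.pos_of_ne_zero (by rintro rfl; omega)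
    refine ⟨⟨γ, ⟨x, hγ⟩, k - 1⟩, ?_⟩
    have h1 : γ.1.ncard * (k - 1 + 1) - 1 = n := by
      rw [Nat.sub_add_cancel hk0, ← hk, Nat.add_sub_cancel]
    refine Sigma.subtype_ext h1 rfl

/-- The contribution of a periodic point to the series defining the zeta function. -/
noncomputable def zetaTerm (t : ℂ) (q : Σ n : ℕ, Per A (n + 1)) : ℂ :=
  t ^ (q.1 + 1) / ((q.1 + 1 : ℕ) : ℂ)

theorem zetaTerm_orbitPeriods (t : ℂ) (q : Σ γ : PeriodicOrbit A, γ.1 × ℕ) :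
    zetaTerm t (orbitPeriods A q) =
      (q.1.1.ncard : ℂ)⁻¹ * ((t ^ q.1.1.ncard) ^ (q.2.2 + 1) / (q.2.2 + 1)) := by
  rw [zetaTerm, orbitPeriods_fst, pow_mul]
  push_cast
  rw [div_mul_eq_div_div, div_right_comm, inv_mul_eq_div, div_right_comm]

theorem zetaConverges_iff_summable_zetaTerm (t : ℂ) :
    ZetaConverges A t ↔ Summable (zetaTerm (A := A) t) := by
  have hfin : ∀ n, Finite (Per A (n + 1)) := fun n => finite_Per n.succ_pos
  rw [← summable_norm_iff, summable_sigma_of_nonneg fun _ => norm_nonneg _, ZetaConverges,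
    ← summable_norm_iff]
  simp only [zetaTerm, tsum_const, Nat.card_coe_set_eq, Summable.of_finite, implies_true,
    true_and, norm_mul, Complex.norm_natCast, nsmul_eq_mul]
  simp only [mul_comm]

theorem zeta_eq_exp_tsum {t : ℂ} (ht : Summable (zetaTerm (A := A) t)) :
    zeta A t = Complex.exp (∑' q, zetaTerm (A := A) t q) := by
  have hfin : ∀ n, Finite (Per A (n + 1)) := fun n => finite_Per n.succ_pos
  rw [zeta, ht.tsum_sigma]
  simp only [zetaTerm, tsum_const, Nat.card_coe_set_eq, nsmul_eq_mul]
  simp only [mul_comm]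

theorem PeriodicOrbit.finite_coe (γ : PeriodicOrbit A) : Finite γ.1 := γ.finite

theorem PeriodicOrbit.hasSum_zetaTerm (γ : PeriodicOrbit A) {t : ℂ} (ht : ‖t‖ < 1) :
    HasSum (fun p : γ.1 × ℕ => zetaTerm t (orbitPeriods A ⟨γ, p⟩))
      (-Complex.log (1 - t ^ γ.1.ncard)) := by
  have := γ.finite_coe
  have hc : (γ.1.ncard : ℂ) ≠ 0 := by exact_mod_cast γ.ncard_pos.ne'
  have hlt : ‖t ^ γ.1.ncard‖ < 1 := by
    rw [norm_pow]
    exact pow_lt_one₀ (norm_nonneg t) ht γ.ncard_pos.ne'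
  have h1 := (Complex.hasSum_taylorSeries_neg_log' hlt).mul_left (γ.1.ncard : ℂ)⁻¹
  have h2 := hasSum_prod_snd (α := γ.1) h1.summable.norm h1
  rw [Nat.card_coe_set_eq, mul_inv_cancel_left₀ hc] at h2
  simpa only [zetaTerm_orbitPeriods] using h2

theorem PeriodicOrbit.hasSum_norm_zetaTerm (γ : PeriodicOrbit A) {t : ℂ} (ht : ‖t‖ < 1) :
    HasSum (fun p : γ.1 × ℕ => ‖zetaTerm t (orbitPeriods A ⟨γ, p⟩)‖)
      (-Real.log (1 - ‖t‖ ^ γ.1.ncard)) := by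
  have := γ.finite_coe
  have hc : (γ.1.ncard : ℝ) ≠ 0 := by exact_mod_cast γ.ncard_pos.ne'
  have hlt : |‖t‖ ^ γ.1.ncard| < 1 := by
    rw [abs_of_nonneg (by positivity)]
    exact pow_lt_one₀ (norm_nonneg t) ht γ.ncard_pos.ne'
  have h1 := (Real.hasSum_pow_div_log_of_abs_lt_one hlt).mul_left (γ.1.ncard : ℝ)⁻¹
  have h2 := hasSum_prod_snd (α := γ.1) h1.summable.norm h1
  rw [Nat.card_coe_set_eq] at h2
  have hterm : (fun p : γ.1 × ℕ => ‖zetaTerm t (orbitPeriods A ⟨γ, p⟩)‖) =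
      fun p => (γ.1.ncard : ℝ)⁻¹ * ((‖t‖ ^ γ.1.ncard) ^ (p.2 + 1) / (p.2 + 1)) := by
    funext p
    rw [zetaTerm_orbitPeriods, norm_mul, norm_inv, Complex.norm_natCast, norm_div, norm_pow,
      norm_pow, ← Nat.cast_succ, Complex.norm_natCast, Nat.cast_succ]
  rw [hterm, ← mul_inv_cancel_left₀ hc (-Real.log (1 - ‖t‖ ^ γ.1.ncard))]
  exact h2

theorem norm_lt_one_of_summable_zetaTerm [Nonempty (PeriodicOrbit A)] {t : ℂ}
    (ht : Summable (zetaTerm (A := A) t)) : ‖t‖ < 1 := by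
  by_contra! h1
  obtain ⟨γ⟩ := ‹Nonempty (PeriodicOrbit A)›
  obtain ⟨x, hx⟩ := γ.nonempty
  have hc : (0 : ℝ) < γ.1.ncard := by exact_mod_cast γ.ncard_pos
  have h2 := (ht.comp_injective bijective_orbitPeriods.1).norm.comp_injective
    (i := fun k : ℕ => (⟨γ, ⟨x, hx⟩, k⟩ : Σ γ : PeriodicOrbit A, γ.1 × ℕ))
    (fun k l h => by simpa using h)
  have h3 : Summable fun k : ℕ => (1 : ℝ) / ((k + 1 : ℕ) : ℝ) := by
    refine (h2.mul_left (γ.1.ncard : ℝ)).of_nonneg_of_le (fun k => by positivity) fun k => ?_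
    simp only [comp_apply, zetaTerm_orbitPeriods]
    rw [norm_mul, norm_inv, Complex.norm_natCast, mul_inv_cancel_left₀ hc.ne', norm_div, norm_pow,
      norm_pow, ← Nat.cast_succ, Complex.norm_natCast]
    gcongr
    exact one_le_pow₀ (one_le_pow₀ h1)
  exact Real.not_summable_one_div_natCast
    ((summable_nat_add_iff (f := fun k : ℕ => (1 : ℝ) / (k : ℝ)) 1).1 h3)

theorem summable_zetaTerm_iff [Nonempty (PeriodicOrbit A)] (t : ℂ) :
    Summable (zetaTerm (A := A) t) ↔
      ‖t‖ < 1 ∧ Summable fun γ : PeriodicOrbit A => t ^ γ.1.ncard := by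
  refine ⟨fun h => ⟨norm_lt_one_of_summable_zetaTerm h, ?_⟩, fun ⟨ht, h⟩ => ?_⟩
  · have ht := norm_lt_one_of_summable_zetaTerm h
    have h1 := (h.comp_injective bijective_orbitPeriods.1).norm.sigma
    simp only [comp_apply, (PeriodicOrbit.hasSum_norm_zetaTerm _ ht).tsum_eq] at h1
    refine Summable.of_norm_bounded h1 fun γ => ?_
    have hlt := pow_lt_one₀ (norm_nonneg t) ht γ.ncard_pos.ne'
    have := Real.log_le_sub_one_of_pos (sub_pos.2 hlt)
    rw [norm_pow]
    linarith
  · rw [← (Equiv.ofBijective _ (bijective_orbitPeriods (A := A))).summable_iff,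
      ← summable_norm_iff, summable_sigma_of_nonneg fun _ => norm_nonneg _]
    simp only [comp_apply, Equiv.ofBijective_apply]
    refine ⟨fun γ => (γ.hasSum_norm_zetaTerm ht).summable, ?_⟩
    simp only [(PeriodicOrbit.hasSum_norm_zetaTerm _ ht).tsum_eq]
    refine (h.norm.mul_right (1 - ‖t‖)⁻¹).of_nonneg_of_le (fun γ => ?_) fun γ => ?_
    · have hlt := pow_lt_one₀ (norm_nonneg t) ht γ.ncard_pos.ne'
      have hnn : 0 ≤ ‖t‖ ^ γ.1.ncard := by positivity
      exact neg_nonneg.2 (Real.log_nonpos (by linarith) (by linarith))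
    · have hlt := pow_lt_one₀ (norm_nonneg t) ht γ.ncard_pos.ne'
      have hpos := sub_pos.2 hlt
      have hle : ‖t‖ ^ γ.1.ncard ≤ ‖t‖ :=
        pow_le_of_le_one (norm_nonneg t) ht.le γ.ncard_pos.ne'
      calc -Real.log (1 - ‖t‖ ^ γ.1.ncard) ≤ (1 - ‖t‖ ^ γ.1.ncard)⁻¹ - 1 := by
            linarith [Real.one_sub_inv_le_log_of_pos hpos]
        _ = ‖t ^ γ.1.ncard‖ * (1 - ‖t‖ ^ γ.1.ncard)⁻¹ := by
            rw [norm_pow]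
            field_simp
            ring
        _ ≤ ‖t ^ γ.1.ncard‖ * (1 - ‖t‖)⁻¹ := by
            refine mul_le_mul_of_nonneg_left (inv_anti₀ (by linarith) (by linarith))
              (norm_nonneg _)

/-- The Euler product of the zeta function over the periodic orbits. -/
theorem hasProd_zeta [Nonempty (PeriodicOrbit A)] {t : ℂ}
    (h : Summable (zetaTerm (A := A) t)) :
    HasProd (fun γ : PeriodicOrbit A => (1 - t ^ γ.1.ncard)⁻¹) (zeta A t) := by
  have ht := norm_lt_one_of_summable_zetaTerm h
  have h1 := ((Equiv.ofBijective _ (bijective_orbitPeriods (A := A))).hasSum_iff.2 h.hasSum).sigma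
    fun γ => γ.hasSum_zetaTerm ht
  rw [zeta_eq_exp_tsum h]
  convert h1.cexp using 2 with γ
  have hne : 1 - t ^ γ.1.ncard ≠ 0 := by
    have hlt := pow_lt_one₀ (norm_nonneg t) ht γ.ncard_pos.ne'
    rw [← norm_pow] at hlt
    intro h0
    rw [← sub_eq_zero.1 h0, norm_one] at hlt
    exact lt_irrefl _ hlt
  rw [comp_apply, Complex.exp_neg, Complex.exp_log hne]

theorem IsContinuousOrbitEquivalence.zeta_eq {h : OneSided A ≃ₜ OneSided B}
    {k₁ l₁ : C(OneSided A, ℕ)} {k₂ l₂ : C(OneSided B, ℕ)}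
    (hh : IsContinuousOrbitEquivalence h k₁ l₁ k₂ l₂)
    (hA : IsTransitionMatrix A) (hB : IsTransitionMatrix B) (t : ℂ) :
    (ZetaConverges B t ↔ UnitZetaConverges (cls A (cocycle k₁ l₁)) t) ∧
      (ZetaConverges B t →
        Multipliable (fun γ : PeriodicOrbit A =>
          (1 - t ^ beta γ (cls A (cocycle k₁ l₁)))⁻¹) ∧
        zeta B t = unitZeta (cls A (cocycle k₁ l₁)) t) := by
  have := hB.nonempty_periodicOrbit
  obtain ⟨Φ, hΦ⟩ := hh.exists_periodicOrbit_equiv hA hB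
  rw [zetaConverges_iff_summable_zetaTerm, UnitZetaConverges, unitZeta]
  simp only [hΦ, zpow_natCast]
  refine ⟨?_, fun ht => ?_⟩
  · rw [summable_zetaTerm_iff]
    exact and_congr_right fun _ => Φ.summable_iff.symm
  · have hprod := Φ.hasProd_iff.2 (hasProd_zeta ht)
    exact ⟨hprod.multipliable, hprod.tprod_eq.symm⟩

end

end MarkovShift

theorem mainTheorem2 {N M : ℕ} (A : Matrix (Fin N) (Fin N) ℤ) (B : Matrix (Fin M) (Fin M) ℤ)
    (hA : MarkovShift.IsTransitionMatrix A) (hB : MarkovShift.IsTransitionMatrix B)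
    (h : MarkovShift.OneSided A ≃ₜ MarkovShift.OneSided B)
    (k₁ l₁ : C(MarkovShift.OneSided A, ℕ)) (k₂ l₂ : C(MarkovShift.OneSided B, ℕ))
    (hh : MarkovShift.IsContinuousOrbitEquivalence h k₁ l₁ k₂ l₂) :
    -- the classes of both cocycle functions are order units
    (MarkovShift.IsOrderUnit A (MarkovShift.cls A (MarkovShift.cocycle k₁ l₁)) ∧
      MarkovShift.IsOrderUnit B (MarkovShift.cls B (MarkovShift.cocycle k₂ l₂))) ∧
    -- all the zeta functions are defined near the origin
    ((∀ᶠ t in 𝓝 (0 : ℂ), MarkovShift.ZetaConverges A t) ∧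
      (∀ᶠ t in 𝓝 (0 : ℂ), MarkovShift.ZetaConverges B t)) ∧
    -- the zeta function of `B` is that of the class of `c₁ = l₁ - k₁`
    (∀ t : ℂ,
      (MarkovShift.ZetaConverges B t ↔
        MarkovShift.UnitZetaConverges (MarkovShift.cls A (MarkovShift.cocycle k₁ l₁)) t) ∧
      (MarkovShift.ZetaConverges B t →
        Multipliable (fun γ : MarkovShift.PeriodicOrbit A =>
          (1 - t ^ MarkovShift.beta γ (MarkovShift.cls A (MarkovShift.cocycle k₁ l₁)))⁻¹) ∧
        MarkovShift.zeta B t =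
          MarkovShift.unitZeta (MarkovShift.cls A (MarkovShift.cocycle k₁ l₁)) t)) ∧
    -- the zeta function of `A` is that of the class of `c₂ = l₂ - k₂`
    (∀ t : ℂ,
      (MarkovShift.ZetaConverges A t ↔
        MarkovShift.UnitZetaConverges (MarkovShift.cls B (MarkovShift.cocycle k₂ l₂)) t) ∧
      (MarkovShift.ZetaConverges A t →
        Multipliable (fun γ : MarkovShift.PeriodicOrbit B =>
          (1 - t ^ MarkovShift.beta γ (MarkovShift.cls B (MarkovShift.cocycle k₂ l₂)))⁻¹) ∧
        MarkovShift.zeta A t =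
          MarkovShift.unitZeta (MarkovShift.cls B (MarkovShift.cocycle k₂ l₂)) t)) := by
  exact ⟨⟨hh.isOrderUnit hA hB, hh.symm.isOrderUnit hB hA⟩,
    ⟨MarkovShift.eventually_zetaConverges A, MarkovShift.eventually_zetaConverges B⟩,
    hh.zeta_eq hA hB, hh.symm.zeta_eq hB hA⟩
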